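/- Let $A$ be a $d\times n$ integer matrix of rank $d$ with $\ker(A)\cap\mathbb{R}^n_{\ge 0}=\{0\}$ and columns $a_1,\dots,a_n$, and let $p_A(b)=\#\{x\in\mathbb{N}^n : Ax=b\}$ for $b\in\mathbb{Z}^d$. For $s\subseteq\{1,\dots,n\}$ let $A_s$ be the submatrix of the columns with index in $s$ and $\operatorname{pos}_{\mathbb{R}}(A_s)$ the cone generated by them; it is a simplicial cone of $A$ if $|s|=\operatorname{rank}(A_s)=d$. The chamber complex of $A$ consists of the cones obtained, for $b\in\operatorname{pos}_{\mathbb{R}}(A)$, as the intersection of all simplicial cones of $A$ containing $b$, along with all their faces; its $d$-dimensional members are the chambers of $A$. For a chamber $\gamma$, $p_A^{\gamma}$ denotes the quasi-polynomial that agrees with $p_A$ on $\gamma\cap\mathbb{Z}^d$. A column $a_j$ is external if it is not in the cone generated by the other columns. Let $\mathcal{L}(A)$ be the lattice and $\mathcal{S}(A)$ the semigroup (containing $0$) generated by the columns of $A$. A semigroup $\mathcal{S}$ is saturated in a lattice $\mathcal{L}$ if $u\in\mathcal{L}$ and $ku\in\mathcal{S}$ for some integer $k\ge 1$ imply $u\in\mathcal{S}$.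 Let $\gamma$ be a chamber of $A$ such that the external columns of $A$ lying in $\gamma$ are exactly $a_1,\dots,a_\ell$, and assume that the semigroup generated by $a_1,\dots,a_\ell$ is saturated in $\mathcal{L}(A)$. Let $\sigma$ be a simplicial cone of $A$ containing $\gamma$. Order the minimal (primitive integer) ray generators $v_1,\dots,v_d$ of $\sigma$ so that $v_i$ is a positive multiple of $a_i$ for $i\le\ell$, and let $M=M_{\sigma^\vee}$ be the dual ray matrix of $\sigma$: its $i$-th row is the minimal ray generator of the dual cone $\sigma^\vee$ that is normal to the facet of $\sigma$ not containing $v_i$. Let $B$ be the matrix obtained from $MA$ by removing the first $\ell$ rows and the first $\ell$ columns. Then $\ell\le d$, the $(d-\ell)\times(n-\ell)$ matrix $B$ has rank $d-\ell$ and satisfies $\ker(B)\cap\mathbb{R}^{n-\ell}_{\ge 0}=\{0\}$, and there is a chamber $\gamma'$ of $B$ such that for all $b\in\gamma\cap\mathcal{S}(A)$ the vector $b':=((Mb)_{\ell+1},\dots,(Mb)_d)$ lies in $\gamma'$, $p_A(b)=p_B(b')$, and $$p_A^{\gamma}(b)=p_B^{\gamma'}(b').$$ -/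

import Mathlib

open Matrix

namespace VPF

section Cones

variable {ι : Type*} [Fintype ι]

/-- The real vector with the same coordinates as an integer vector. -/
def toReal (w : ι → ℤ) : ι → ℝ := fun i => (w i : ℝ)

/-- The dimension of a cone: the dimension of the subspace that it generates. -/
noncomputable def coneDim (C : PointedCone ℝ (ι → ℝ)) : ℕ :=
  Module.finrank ℝ (Submodule.span ℝ (C : Set (ι → ℝ)))

/-- The dual cone `{m | m ⬝ u ≥ 0 for all u ∈ C}`. -/
noncomputable def dualCone (C : PointedCone ℝ (ι → ℝ)) : PointedCone ℝ (ι → ℝ) :=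
  PointedCone.dual (dotProductBilin ℝ ℝ) (C : Set (ι → ℝ))

/-- `F` is a face of `C`: it is cut out of `C` by a linear form `m` that is nonnegative on `C`.
(For `m = 0` this is `C` itself; otherwise it is the intersection with a supporting hyperplane.) -/
def IsFace (F C : PointedCone ℝ (ι → ℝ)) : Prop :=
  ∃ m ∈ dualCone C, ∀ u, u ∈ F ↔ u ∈ C ∧ m ⬝ᵥ u = 0

/-- `w` is a minimal ray generator of `C`: an integer vector whose coordinates have greatest common
divisor one (in particular `w ≠ 0`) and which generates a one-dimensional face of `C`. -/
def IsMinimalRayGenerator (w : ι → ℤ) (C : PointedCone ℝ (ι → ℝ)) : Prop :=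
  Finset.univ.gcd w = 1 ∧ IsFace (PointedCone.hull ℝ {toReal w}) C

/-- `v` is an ordering, indexed by `ι`, of the set of minimal ray generators of `C`. -/
def IsRayOrdering (v : ι → ι → ℤ) (C : PointedCone ℝ (ι → ℝ)) : Prop :=
  Function.Injective v ∧ ∀ w, IsMinimalRayGenerator w C ↔ w ∈ Set.range v

/-- `M` is the dual ray matrix of the (simplicial) cone `C` for the ordering `v` of the minimal ray
generators of `C`: row `i` of `M` is the minimal ray generator of the dual cone that is normal to
the facet of `C` which does not contain `v i`. -/
def IsDualRayMatrix (C : PointedCone ℝ (ι → ℝ)) (v : ι → ι → ℤ) (M : Matrix ι ι ℤ) : Prop :=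
  ∀ i, IsMinimalRayGenerator (M i) (dualCone C) ∧ M i ⬝ᵥ v i ≠ 0

/-- Quasi-polynomials: finite sums of monomials whose coefficients are periodic functions, i.e.
depend only on the residues of the coordinates modulo some positive integers. -/
def IsQuasiPolynomial (q : (ι → ℤ) → ℚ) : Prop :=
  ∃ (S : Finset (ι → ℕ)) (c : (ι → ℕ) → (ι → ℤ) → ℚ) (N : ι → ℕ),
    (∀ i, 0 < N i) ∧
    (∀ e ∈ S, ∀ z z' : ι → ℤ, (∀ i, z i ≡ z' i [ZMOD (N i : ℤ)]) → c e z = c e z') ∧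
    ∀ z, q z = ∑ e ∈ S, c e z * ∏ i, (z i : ℚ) ^ e i

end Cones

section Matrices

variable {ι κ : Type*} [Fintype ι] [Fintype κ]

/-- The standing assumption on the matrix of a vector partition function: its rank is the number
of its rows, and its kernel meets the nonnegative orthant only in zero. -/
def IsAdmissible (A : Matrix ι κ ℤ) : Prop :=
  (A.map (Int.cast : ℤ → ℝ)).rank = Fintype.card ι ∧
    ∀ x : κ → ℝ, (∀ j, 0 ≤ x j) → A.map (Int.cast : ℤ → ℝ) *ᵥ x = 0 → x = 0

/-- The vector partition function `p_A`. -/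
noncomputable def partitionFun (A : Matrix ι κ ℤ) (b : ι → ℤ) : ℕ :=
  Set.ncard {x : κ → ℕ | A *ᵥ (fun j => (x j : ℤ)) = b}

/-- The cone generated by the columns of `A` with index in `s`. -/
def posCone (A : Matrix ι κ ℤ) (s : Set κ) : PointedCone ℝ (ι → ℝ) :=
  PointedCone.hull ℝ ((fun j => toReal (A.col j)) '' s)

/-- `s` indexes a simplicial cone `posCone A s` of `A`: `|s| = rank A_s = d`, the number of rows. -/
def IsSimplicialIndex (A : Matrix ι κ ℤ) (s : Finset κ) : Prop :=
  s.card = Fintype.card ι ∧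
    ((A.submatrix id (Subtype.val : s → κ)).map (Int.cast : ℤ → ℝ)).rank = Fintype.card ι

/-- The intersection of all simplicial cones of `A` that contain `b`. -/
def coneAt (A : Matrix ι κ ℤ) (b : ι → ℝ) : PointedCone ℝ (ι → ℝ) :=
  ⨅ s ∈ {s : Finset κ | IsSimplicialIndex A s ∧ b ∈ posCone A (s : Set κ)}, posCone A (s : Set κ)

/-- The chamber complex of `A`: the cones `coneAt A b` for `b` in the cone of all columns of `A`,
along with all of their faces. -/
def chamberComplex (A : Matrix ι κ ℤ) : Set (PointedCone ℝ (ι → ℝ)) :=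
  {F | ∃ b ∈ posCone A Set.univ, IsFace F (coneAt A b)}

/-- A chamber of `A`: a full-dimensional cone of the chamber complex. -/
def IsChamber (A : Matrix ι κ ℤ) (γ : PointedCone ℝ (ι → ℝ)) : Prop :=
  γ ∈ chamberComplex A ∧ coneDim γ = Fintype.card ι

/-- Column `j` is external: it is not in the cone generated by the other columns. -/
def IsExternal (A : Matrix ι κ ℤ) (j : κ) : Prop :=
  toReal (A.col j) ∉ posCone A {j}ᶜ

/-- The affine semigroup generated by the columns of `A` with index in `s`. -/
def semigroup (A : Matrix ι κ ℤ) (s : Set κ) : AddSubmonoid (ι → ℤ) :=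
  AddSubmonoid.closure (A.col '' s)

/-- The lattice generated by all columns of `A`. -/
def lattice (A : Matrix ι κ ℤ) : AddSubgroup (ι → ℤ) :=
  AddSubgroup.closure (Set.range A.col)

/-- The semigroup `S` is saturated in the lattice `L`. -/
def IsSaturated (S : AddSubmonoid (ι → ℤ)) (L : AddSubgroup (ι → ℤ)) : Prop :=
  ∀ k : ℕ, 0 < k → ∀ u ∈ L, k • u ∈ S → u ∈ S

/-- `q` is the quasi-polynomial `p_A^γ` of the chamber `γ` of `A`: the quasi-polynomial that agrees
with the vector partition function `p_A` at all integer points of `γ`. -/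
def IsChamberQuasiPolynomial (A : Matrix ι κ ℤ) (γ : PointedCone ℝ (ι → ℝ))
    (q : (ι → ℤ) → ℚ) : Prop :=
  IsQuasiPolynomial q ∧ ∀ b : ι → ℤ, toReal b ∈ γ → q b = (partitionFun A b : ℚ)

end Matrices

/-- The index `ℓ + i`, as `i` runs through the indices that remain after the first `ℓ` of `d`
indices are removed. -/
def tailIdx (ℓ : ℕ) {d : ℕ} (i : Fin (d - ℓ)) : Fin d := ⟨ℓ + i, by omega⟩

/-- The vector `(u_{ℓ+1}, …, u_d)`. -/
def dropVec (ℓ : ℕ) {d : ℕ} (u : Fin d → ℤ) : Fin (d - ℓ) → ℤ := fun i => u (tailIdx ℓ i)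

/-- The matrix obtained by removing the first `ℓ` rows and the first `ℓ` columns. -/
def dropMat (ℓ : ℕ) {d n : ℕ} (A : Matrix (Fin d) (Fin n) ℤ) :
    Matrix (Fin (d - ℓ)) (Fin (n - ℓ)) ℤ := A.submatrix (tailIdx ℓ) (tailIdx ℓ)

end VPF

/-!
Let `a_j` be the columns of `A`, of which the first `ℓ` are the external columns in the chamber `γ`,
and let `P` be the map `u ↦ ((M u)_{ℓ+1}, …, (M u)_d)`. The dual ray matrix is, up to positive
factors, the dual basis of the ray generators of `σ`, so `P` is onto, its kernel is spanned by
`a_1, …, a_ℓ` (which are linearly independent), and `P` maps the remaining columns of `A` to the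
columns of `B`. Forgetting the first `ℓ` coordinates therefore maps the solutions of `A x = b`
injectively to those of `B y = b'`.

What makes this map surjective is a sign property of chambers (`IsChamber.coeff_nonneg`): if a
combination of the columns lies in `γ` and its coefficients outside `a_1, …, a_ℓ` are nonnegative,
then all its coefficients are. It follows from `IsChamber.exists_separating`: for an external column
`a_j` in `γ` there is a linear form that is `1` on `a_j`, nonpositive on all other columns and
nonnegative on `γ`. Every simplicial cone through a generic point of `γ` contains `γ`, hence uses
the column `a_j`; among these cones take one that minimizes the coefficient of `a_j` at that point.
Its coordinate form at `a_j` is the required one, since otherwise a simplex exchange would lower the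
coefficient or remove `a_j` from the basis.

By the sign property, a solution `y` of `B y = b'` lifts to a nonnegative real solution of `A x = b`
(`IsReducing.exists_lift`). Its first `ℓ` coefficients are rational, so saturation replaces them by
natural numbers. The same lifting over the reals, applied to `0`, shows that `ker B` meets the
orthant only in `0`. Applied to a point `b₀` with `γ = coneAt A b₀`, it shows that every simplicial
cone of `B` containing `P b₀` comes from a simplicial cone of `A` containing `b₀`, so that
`P γ ⊆ coneAt B (P b₀)`, and the latter is the chamber `γ'`.
-/

namespace VPF

/-! ### Cones and dot products -/

section Vectors

variable {ι : Type*}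

lemma mem_hull_singleton {w u : ι → ℝ} :
    u ∈ PointedCone.hull ℝ {w} ↔ ∃ t : ℝ, 0 ≤ t ∧ u = t • w := by
  rw [PointedCone.hull, Submodule.mem_span_singleton]
  constructor
  · rintro ⟨⟨t, ht⟩, rfl⟩
    exact ⟨t, ht, rfl⟩
  · rintro ⟨t, ht, rfl⟩
    exact ⟨⟨t, ht⟩, rfl⟩

lemma toReal_injective : Function.Injective (toReal : (ι → ℤ) → ι → ℝ) := by
  intro u v h
  ext i
  exact Int.cast_injective (congrFun h i)

lemma toReal_sub (u v : ι → ℤ) : toReal (u - v) = toReal u - toReal v := by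
  ext i; simp [toReal]

variable [Fintype ι]

lemma toReal_dotProduct (u v : ι → ℤ) : toReal u ⬝ᵥ toReal v = ((u ⬝ᵥ v : ℤ) : ℝ) := by
  simp [toReal, dotProduct]

lemma mem_dualCone {C : PointedCone ℝ (ι → ℝ)} {m : ι → ℝ} :
    m ∈ dualCone C ↔ ∀ u ∈ C, 0 ≤ m ⬝ᵥ u := by
  unfold dualCone
  rw [PointedCone.mem_dual]
  constructor
  · intro h u hu
    rw [dotProduct_comm]
    exact h hu
  · intro h u hu
    have := h u hu
    rw [dotProduct_comm] at this
    exact this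

lemma exists_dotProduct_eq (f : (ι → ℝ) →ₗ[ℝ] ℝ) : ∃ w : ι → ℝ, ∀ u, w ⬝ᵥ u = f u := by
  classical
  refine ⟨fun i => f (Pi.single i 1), fun u => ?_⟩
  rw [LinearMap.pi_apply_eq_sum_univ f u]
  refine Finset.sum_congr rfl fun i _ => ?_
  rw [smul_eq_mul, mul_comm]
  refine congrArg (u i * ·) (congrArg f ?_)
  funext j
  simp [Pi.single_apply, eq_comm]

lemma eq_zero_of_dotProduct_eq_zero {s : Set (ι → ℝ)} (hs : Submodule.span ℝ s = ⊤)
    {m : ι → ℝ} (hm : ∀ u ∈ s, m ⬝ᵥ u = 0) : m = 0 := by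
  have key : ∀ u ∈ Submodule.span ℝ s, m ⬝ᵥ u = 0 := by
    intro u hu
    induction hu using Submodule.span_induction with
    | mem u hu => exact hm u hu
    | zero => simp
    | add u v _ _ hu hv => rw [dotProduct_add, hu, hv, add_zero]
    | smul c u _ hu => rw [dotProduct_smul, hu, smul_zero]
  exact dotProduct_self_eq_zero.1 (key m (hs ▸ Submodule.mem_top))

end Vectors

/-! ### Cones of columns -/

section Columns

variable {ι κ : Type*} {A : Matrix ι κ ℤ}

lemma col_mem_posCone {s : Set κ} {j : κ} (hj : j ∈ s) : toReal (A.col j) ∈ posCone A s :=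
  Submodule.subset_span ⟨j, hj, rfl⟩

lemma posCone_mono {s t : Set κ} (h : s ⊆ t) : posCone A s ≤ posCone A t :=
  Submodule.span_mono (Set.image_mono h)

lemma IsExternal.mem_of_mem_posCone {j : κ} (h : IsExternal A j) {s : Set κ}
    (hj : toReal (A.col j) ∈ posCone A s) : j ∈ s := by
  by_contra hjs
  exact h (posCone_mono (fun k hk => by rintro rfl; exact hjs hk) hj)

variable [Fintype κ]

lemma map_mulVec_eq_sum (A : Matrix ι κ ℤ) (x : κ → ℝ) :
    A.map (Int.cast : ℤ → ℝ) *ᵥ x = ∑ j, x j • toReal (A.col j) := by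
  ext i
  simp [mulVec, dotProduct, toReal, Matrix.col, mul_comm]

lemma toReal_mulVec (A : Matrix ι κ ℤ) (x : κ → ℤ) :
    toReal (A *ᵥ x) = ∑ j, (x j : ℝ) • toReal (A.col j) := by
  ext i
  simp [mulVec, dotProduct, toReal, Matrix.col, mul_comm]

lemma mem_posCone_iff {s : Set κ} {u : ι → ℝ} :
    u ∈ posCone A s ↔ ∃ x : κ → ℝ, (∀ j, 0 ≤ x j) ∧ (∀ j, j ∉ s → x j = 0) ∧
      u = ∑ j, x j • toReal (A.col j) := by
  classical
  constructor
  · intro hu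
    unfold posCone PointedCone.hull at hu
    induction hu using Submodule.span_induction with
    | mem u hu =>
      obtain ⟨j, hj, rfl⟩ := hu
      refine ⟨Pi.single j 1, fun k => ?_, fun k hk => ?_, ?_⟩
      · rw [Pi.single_apply]; split_ifs <;> norm_num
      · rw [Pi.single_apply, if_neg]
        rintro rfl
        exact hk hj
      · simp [Pi.single_apply, ite_smul]
    | zero => exact ⟨0, fun _ => le_rfl, fun _ _ => rfl, by simp⟩
    | add u v _ _ hu hv =>
      obtain ⟨x, hx, hx', rfl⟩ := hu
      obtain ⟨y, hy, hy', rfl⟩ := hv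
      refine ⟨x + y, fun j => add_nonneg (hx j) (hy j), fun j hj => ?_, ?_⟩
      · simp [hx' j hj, hy' j hj]
      · simp [add_smul, Finset.sum_add_distrib]
    | smul c u _ hu =>
      obtain ⟨x, hx, hx', rfl⟩ := hu
      refine ⟨(c : ℝ) • x, fun j => mul_nonneg c.2 (hx j), fun j hj => ?_, ?_⟩
      · simp [hx' j hj]
      · rw [Finset.smul_sum]
        refine Finset.sum_congr rfl fun j _ => ?_
        rw [Pi.smul_apply, smul_assoc]
        rfl
  · rintro ⟨x, hx, hx', rfl⟩
    refine Submodule.sum_mem _ fun j _ => ?_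
    by_cases hj : j ∈ s
    · exact PointedCone.smul_mem _ (hx j) (col_mem_posCone hj)
    · rw [hx' j hj, zero_smul]
      exact Submodule.zero_mem _

end Columns

/-! ### Simplicial cones and their coordinates -/

section Simplicial

variable {ι κ : Type*} [Fintype ι] {A : Matrix ι κ ℤ}

lemma isSimplicialIndex_iff {s : Finset κ} :
    IsSimplicialIndex A s ↔ s.card = Fintype.card ι ∧
      LinearIndepOn ℝ (fun j => toReal (A.col j)) (s : Set κ) := by
  unfold IsSimplicialIndex
  refine and_congr_right fun hs => ?_
  rw [Matrix.rank_eq_finrank_span_cols, LinearIndepOn,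
    linearIndependent_iff_card_eq_finrank_span, ← hs]
  have : Set.range ((A.submatrix id (Subtype.val : s → κ)).map (Int.cast : ℤ → ℝ)).col =
      Set.range (fun j : (s : Set κ) => toReal (A.col j)) := rfl
  rw [this, Set.finrank]
  simp [eq_comm]

/-- `w k`, for `k ∈ s`, represents by the dot product the coordinate of column `k` with respect
to the columns of `A` with index in `s`, which form a basis. The values of `w` outside `s` are
irrelevant. -/
structure IsCoordSystem (A : Matrix ι κ ℤ) (s : Finset κ) (w : κ → ι → ℝ) : Prop where
  sum_eq : ∀ u, ∑ k ∈ s, (w k ⬝ᵥ u) • toReal (A.col k) = u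
  self : ∀ k ∈ s, w k ⬝ᵥ toReal (A.col k) = 1
  ne : ∀ k ∈ s, ∀ j ∈ s, k ≠ j → w k ⬝ᵥ toReal (A.col j) = 0

lemma IsSimplicialIndex.exists_isCoordSystem {s : Finset κ} (hs : IsSimplicialIndex A s) :
    ∃ w, IsCoordSystem A s w := by
  classical
  obtain ⟨hc, hli⟩ := isSimplicialIndex_iff.1 hs
  have hli' : LinearIndependent ℝ (fun j : s => toReal (A.col j)) := hli
  have hcard : Fintype.card s = Module.finrank ℝ (ι → ℝ) := by simp [hc]
  let b : Module.Basis s ℝ (ι → ℝ) := Module.Basis.mk hli'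
    (hli'.span_eq_top_of_card_eq_finrank' hcard).ge
  have hb : ∀ j, b j = toReal (A.col j) := fun j => by simp [b]
  choose w hw using fun k : s => exists_dotProduct_eq (b.coord k)
  have hw' : ∀ k (hk : k ∈ s), (if h : k ∈ s then w ⟨k, h⟩ else 0) = w ⟨k, hk⟩ :=
    fun k hk => dif_pos hk
  refine ⟨fun k => if h : k ∈ s then w ⟨k, h⟩ else 0, fun u => ?_, fun k hk => ?_,
    fun k hk j hj hkj => ?_⟩
  · rw [← Finset.sum_coe_sort]
    conv_rhs => rw [← b.sum_repr u]
    refine Finset.sum_congr rfl fun k _ => ?_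
    simp [hw, hb]
  · rw [hw' k hk, hw, ← hb ⟨k, hk⟩]
    simp
  · rw [hw' k hk, hw, ← hb ⟨j, hj⟩]
    simp [hkj.symm]

namespace IsCoordSystem

variable {s : Finset κ} {w : κ → ι → ℝ}

lemma mem_posCone_iff [Fintype κ] (h : IsCoordSystem A s w) {u : ι → ℝ} :
    u ∈ posCone A (s : Set κ) ↔ ∀ k ∈ s, 0 ≤ w k ⬝ᵥ u := by
  constructor
  · intro hu k hk
    obtain ⟨x, hx, hx', rfl⟩ := VPF.mem_posCone_iff.1 hu
    rw [dotProduct_sum]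
    refine Finset.sum_nonneg fun j _ => ?_
    rw [dotProduct_smul, smul_eq_mul]
    by_cases hj : j ∈ s
    · refine mul_nonneg (hx j) ?_
      by_cases hkj : k = j
      · subst hkj; rw [h.self k hk]; exact zero_le_one
      · rw [h.ne k hk j hj hkj]
    · rw [hx' j hj, zero_mul]
  · intro hu
    rw [← h.sum_eq u]
    exact Submodule.sum_mem _ fun k hk => PointedCone.smul_mem _ (hu k hk) (col_mem_posCone hk)

lemma coord_ne_zero (h : IsCoordSystem A s w) {k : κ} (hk : k ∈ s) : w k ≠ 0 := by
  intro h0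
  have := h.self k hk
  rw [h0, zero_dotProduct] at this
  exact zero_ne_one this

/-- The exchange step of the simplex method. -/
lemma exchange [DecidableEq κ] (hs : IsSimplicialIndex A s) (h : IsCoordSystem A s w) {r k : κ}
    (hr : r ∈ s) (hk : k ∉ s) (hrk : w r ⬝ᵥ toReal (A.col k) ≠ 0) :
    IsSimplicialIndex A (insert k (s.erase r)) := by
  obtain ⟨hc, hli⟩ := isSimplicialIndex_iff.1 hs
  refine isSimplicialIndex_iff.2 ⟨?_, ?_⟩
  · rw [Finset.card_insert_of_notMem (fun h' => hk (Finset.mem_of_mem_erase h')),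
      Finset.card_erase_add_one hr, hc]
  · rw [Finset.coe_insert]
    refine (hli.mono (by simp)).insert fun hmem => hrk ?_
    have key : ∀ u ∈ Submodule.span ℝ ((fun j => toReal (A.col j)) '' ↑(s.erase r)),
        w r ⬝ᵥ u = 0 := by
      intro u hu
      induction hu using Submodule.span_induction with
      | mem u hu =>
        obtain ⟨j, hj, rfl⟩ := hu
        obtain ⟨hjr, hjs⟩ := Finset.mem_erase.1 hj
        exact h.ne r hr j hjs (Ne.symm hjr)
      | zero => simp
      | add u v _ _ hu hv => rw [dotProduct_add, hu, hv, add_zero]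
      | smul c u _ hu => rw [dotProduct_smul, hu, smul_zero]
    exact key _ hmem

end IsCoordSystem

end Simplicial

/-! ### Chambers -/

section Chambers

variable {ι κ : Type*} [Fintype ι] {A : Matrix ι κ ℤ} {γ : PointedCone ℝ (ι → ℝ)}

lemma mem_coneAt {b u : ι → ℝ} : u ∈ coneAt A b ↔
    ∀ s : Finset κ, IsSimplicialIndex A s → b ∈ posCone A (s : Set κ) →
      u ∈ posCone A (s : Set κ) := by
  unfold coneAt
  simp only [Submodule.mem_iInf, Set.mem_ofPred_eq, and_imp]

lemma IsChamber.span_eq_top (hγ : IsChamber A γ) :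
    Submodule.span ℝ (γ : Set (ι → ℝ)) = ⊤ := by
  apply Submodule.eq_top_of_finrank_eq
  rw [Module.finrank_fintype_fun_eq_card]
  exact hγ.2

/-- A proper face lies in a hyperplane, so a full-dimensional member of the chamber complex is
one of the cones `coneAt A b`. -/
lemma IsChamber.exists_eq_coneAt (hγ : IsChamber A γ) :
    ∃ b ∈ posCone A Set.univ, γ = coneAt A b := by
  obtain ⟨b, hb, m, hm, hF⟩ := hγ.1
  refine ⟨b, hb, ?_⟩
  have h0 : m = 0 := eq_zero_of_dotProduct_eq_zero hγ.span_eq_top fun u hu => ((hF u).1 hu).2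
  subst h0
  ext u
  rw [hF u, zero_dotProduct]
  exact and_iff_left rfl

/-- A full-dimensional cone contains a point at which all nonzero members of the dual cone are
positive. -/
lemma exists_pos_of_span_eq_top (hγ : Submodule.span ℝ (γ : Set (ι → ℝ)) = ⊤) :
    ∃ g ∈ γ, ∀ m ∈ dualCone γ, m ≠ 0 → 0 < m ⬝ᵥ g := by
  obtain ⟨t, htγ, hspan, hli⟩ := exists_linearIndependent ℝ (γ : Set (ι → ℝ))
  have hfin : t.Finite := hli.setFinite
  refine ⟨∑ u ∈ hfin.toFinset, u,
    Submodule.sum_mem _ fun u hu => htγ (hfin.mem_toFinset.1 hu), fun m hm hm0 => ?_⟩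
  rw [dotProduct_sum]
  have hnn : ∀ u ∈ hfin.toFinset, 0 ≤ m ⬝ᵥ u :=
    fun u hu => mem_dualCone.1 hm u (htγ (hfin.mem_toFinset.1 hu))
  refine lt_of_le_of_ne (Finset.sum_nonneg hnn) fun h => hm0 ?_
  rw [eq_comm, Finset.sum_eq_zero_iff_of_nonneg hnn] at h
  exact eq_zero_of_dotProduct_eq_zero (hspan.trans hγ)
    fun u hu => h u (hfin.mem_toFinset.2 hu)

variable [Fintype κ]

/-- A chamber contains an interior point `b` such that every simplicial cone containing `b`
contains the whole chamber. -/
lemma IsChamber.exists_generic (hγ : IsChamber A γ) :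
    ∃ b ∈ γ, (∀ s : Finset κ, IsSimplicialIndex A s → b ∈ posCone A (s : Set κ) →
      γ ≤ posCone A (s : Set κ)) ∧ ∀ m ∈ dualCone γ, m ≠ 0 → 0 < m ⬝ᵥ b := by
  classical
  obtain ⟨b, -, rfl⟩ := hγ.exists_eq_coneAt
  obtain ⟨g, hg, hgpos⟩ := exists_pos_of_span_eq_top hγ.span_eq_top
  have hb : b ∈ coneAt A b := mem_coneAt.2 fun _ _ h => h
  -- The point is `b + ε g`: a simplicial cone that misses `b` misses it for all small `ε`.
  have hev : ∀ s : Finset κ, ∀ᶠ ε : ℝ in nhdsWithin 0 (Set.Ioi 0),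
      IsSimplicialIndex A s → b + ε • g ∈ posCone A (s : Set κ) →
        b ∈ posCone A (s : Set κ) := by
    intro s
    by_cases hs : IsSimplicialIndex A s
    swap
    · exact Filter.Eventually.of_forall fun _ h => absurd h hs
    by_cases hbs : b ∈ posCone A (s : Set κ)
    · exact Filter.Eventually.of_forall fun _ _ _ => hbs
    obtain ⟨w, hw⟩ := hs.exists_isCoordSystem
    rw [hw.mem_posCone_iff] at hbs
    push Not at hbs
    obtain ⟨k, hk, hneg⟩ := hbs
    have hcont : Continuous fun ε : ℝ => w k ⬝ᵥ b + ε * (w k ⬝ᵥ g) := by fun_prop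
    have hlt : ∀ᶠ ε : ℝ in nhds 0, w k ⬝ᵥ b + ε * (w k ⬝ᵥ g) < 0 :=
      hcont.continuousAt.eventually_lt continuousAt_const (by simpa using hneg)
    filter_upwards [nhdsWithin_le_nhds hlt] with ε hε _ hmem
    have := hw.mem_posCone_iff.1 hmem k hk
    rw [dotProduct_add, dotProduct_smul, smul_eq_mul] at this
    exact absurd this (not_le.2 hε)
  obtain ⟨ε, hε, hε0⟩ :=
    ((Filter.eventually_all.2 hev).and self_mem_nhdsWithin).exists
  have hε0 : 0 < ε := hε0
  refine ⟨b + ε • g, Submodule.add_mem _ hb (PointedCone.smul_mem _ hε0.le hg),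
    fun s hs hmem u hu => mem_coneAt.1 hu s hs (hε s hs hmem), fun m hm hm0 => ?_⟩
  rw [dotProduct_add, dotProduct_smul, smul_eq_mul]
  exact add_pos_of_nonneg_of_pos (mem_dualCone.1 hm b hb) (mul_pos hε0 (hgpos m hm hm0))

/-- An external column in a chamber is separated from all other columns by a linear form that is
nonnegative on the chamber. The form is the coordinate of the external column with respect to an
optimal basis of the linear program that minimizes the multiplicity of that column in a
representation of a generic point of the chamber. -/
lemma IsChamber.exists_separating (hγ : IsChamber A γ) {s : Finset κ}
    (hs : IsSimplicialIndex A s) (hγs : γ ≤ posCone A (s : Set κ)) {j : κ}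
    (hj : IsExternal A j) (hjγ : toReal (A.col j) ∈ γ) :
    ∃ m : ι → ℝ, m ⬝ᵥ toReal (A.col j) = 1 ∧ (∀ k, k ≠ j → m ⬝ᵥ toReal (A.col k) ≤ 0) ∧
      ∀ u ∈ γ, 0 ≤ m ⬝ᵥ u := by
  classical
  obtain ⟨b, hbγ, hb, hpos⟩ := hγ.exists_generic
  choose! w hw using fun (t : Finset κ) (ht : IsSimplicialIndex A t) => ht.exists_isCoordSystem
  obtain ⟨t, ht, hmin⟩ := Finset.exists_min_image
    (Finset.univ.filter fun t : Finset κ => IsSimplicialIndex A t ∧ b ∈ posCone A (t : Set κ))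
    (fun t => w t j ⬝ᵥ b) ⟨s, by simpa using ⟨hs, hγs hbγ⟩⟩
  obtain ⟨hts, hbt⟩ := (Finset.mem_filter.1 ht).2
  have hγt := hb t hts hbt
  have hwt := hw t hts
  have hjt : j ∈ t := by simpa using hj.mem_of_mem_posCone (hγt hjγ)
  refine ⟨w t j, hwt.self j hjt, fun k hkj => ?_,
    fun u hu => hwt.mem_posCone_iff.1 (hγt hu) j hjt⟩
  by_contra! hcj
  have hkt : k ∉ t := fun hkt => hcj.ne' (hwt.ne j hjt k hkt hkj.symm)
  have hβ : ∀ i ∈ t, 0 < w t i ⬝ᵥ b := fun i hi =>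
    hpos _ (mem_dualCone.2 fun u hu => hwt.mem_posCone_iff.1 (hγt hu) i hi)
      (hwt.coord_ne_zero hi)
  -- Let column `k` enter the basis; `r` is the leaving column, chosen by the ratio test.
  obtain ⟨r, hr, hrmin⟩ := Finset.exists_min_image
    (t.filter fun i => 0 < w t i ⬝ᵥ toReal (A.col k))
    (fun i => (w t i ⬝ᵥ b) / (w t i ⬝ᵥ toReal (A.col k))) ⟨j, by simpa using ⟨hjt, hcj⟩⟩
  obtain ⟨hrt, hcr⟩ := Finset.mem_filter.1 hr
  obtain ⟨τ, hτ⟩ : ∃ τ, τ = (w t r ⬝ᵥ b) / (w t r ⬝ᵥ toReal (A.col k)) := ⟨_, rfl⟩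
  have hτ0 : 0 < τ := hτ ▸ div_pos (hβ r hrt) hcr
  have hcoef : ∀ i ∈ t, 0 ≤ w t i ⬝ᵥ (b - τ • toReal (A.col k)) := by
    intro i hi
    rw [dotProduct_sub, dotProduct_smul, smul_eq_mul, sub_nonneg]
    by_cases hci : 0 < w t i ⬝ᵥ toReal (A.col k)
    · rw [← le_div_iff₀ hci, hτ]
      exact hrmin i (Finset.mem_filter.2 ⟨hi, hci⟩)
    · exact (mul_nonpos_of_nonneg_of_nonpos hτ0.le (not_lt.1 hci)).trans (hβ i hi).le
  have hcoefr : w t r ⬝ᵥ (b - τ • toReal (A.col k)) = 0 := by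
    rw [dotProduct_sub, dotProduct_smul, smul_eq_mul, hτ, div_mul_cancel₀ _ hcr.ne', sub_self]
  have hexp : b = ∑ i ∈ t.erase r, (w t i ⬝ᵥ (b - τ • toReal (A.col k))) • toReal (A.col i) +
      τ • toReal (A.col k) := by
    rw [Finset.sum_erase _ (by rw [hcoefr, zero_smul]), hwt.sum_eq, sub_add_cancel]
  have ht's := hwt.exchange hts hrt hkt hcr.ne'
  have hbt' : b ∈ posCone A ((insert k (t.erase r) : Finset κ) : Set κ) := by
    rw [hexp]
    refine Submodule.add_mem _ (Submodule.sum_mem _ fun i hi => ?_) ?_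
    · exact PointedCone.smul_mem _ (hcoef i (Finset.mem_of_mem_erase hi))
        (col_mem_posCone (by exact_mod_cast Finset.mem_insert_of_mem hi))
    · exact PointedCone.smul_mem _ hτ0.le (col_mem_posCone (by simp))
  have hjt' : j ∈ insert k (t.erase r) := by
    exact_mod_cast hj.mem_of_mem_posCone (hb _ ht's hbt' hjγ)
  have hjr : j ∈ t.erase r := (Finset.mem_insert.1 hjt').resolve_left hkj.symm
  have hwt' := hw _ ht's
  -- The new basis has a smaller coordinate at `j`, which contradicts the choice of `t`.
  have hval : w (insert k (t.erase r)) j ⬝ᵥ b = w t j ⬝ᵥ (b - τ • toReal (A.col k)) := by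
    conv_lhs => rw [hexp]
    rw [dotProduct_add, dotProduct_smul, hwt'.ne j hjt' k (Finset.mem_insert_self _ _) hkj.symm,
      smul_zero, add_zero, dotProduct_sum, Finset.sum_eq_single_of_mem j hjr]
    · rw [dotProduct_smul, hwt'.self j hjt', smul_eq_mul, mul_one]
    · intro i hi hij
      rw [dotProduct_smul, hwt'.ne j hjt' i (Finset.mem_insert_of_mem hi) hij.symm, smul_zero]
  have hle := hmin (insert k (t.erase r)) (Finset.mem_filter.2 ⟨Finset.mem_univ _, ht's, hbt'⟩)
  rw [hval, dotProduct_sub, dotProduct_smul, smul_eq_mul] at hle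
  linarith [mul_pos hτ0 hcj]

/-- In a combination of the columns that lies in a chamber, the coefficients of the external
columns in that chamber are nonnegative as soon as all other coefficients are. -/
lemma IsChamber.coeff_nonneg (hγ : IsChamber A γ) {s : Finset κ}
    (hs : IsSimplicialIndex A s) (hγs : γ ≤ posCone A (s : Set κ)) {x : κ → ℝ}
    (hx : ∀ j, ¬ (IsExternal A j ∧ toReal (A.col j) ∈ γ) → 0 ≤ x j)
    (hxγ : ∑ j, x j • toReal (A.col j) ∈ γ) (j : κ) : 0 ≤ x j := by
  classical
  by_cases hj : IsExternal A j ∧ toReal (A.col j) ∈ γ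
  swap
  · exact hx j hj
  obtain ⟨m, hm1, hm0, hmγ⟩ := hγ.exists_separating hs hγs hj.1 hj.2
  -- Raising the negative coefficients other than `x j` to zero does not leave the chamber.
  let y : κ → ℝ := fun k => if k = j then x j else max (x k) 0
  have hyγ : ∑ k, y k • toReal (A.col k) ∈ γ := by
    have hsplit : ∑ k, y k • toReal (A.col k) =
        ∑ k, x k • toReal (A.col k) + ∑ k, (y k - x k) • toReal (A.col k) := by
      rw [← Finset.sum_add_distrib]
      exact Finset.sum_congr rfl fun k _ => by rw [← add_smul, add_sub_cancel]
    rw [hsplit]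
    refine Submodule.add_mem _ hxγ (Submodule.sum_mem _ fun k _ => ?_)
    by_cases hk : IsExternal A k ∧ toReal (A.col k) ∈ γ
    · refine PointedCone.smul_mem _ (sub_nonneg.2 ?_) hk.2
      by_cases hkj : k = j
      · simp [y, hkj]
      · simp [y, hkj]
    · have : y k - x k = 0 := by
        by_cases hkj : k = j
        · simp [y, hkj]
        · simp [y, hkj, hx k hk]
      rw [this, zero_smul]
      exact Submodule.zero_mem _
  have h0 := hmγ _ hyγ
  rw [dotProduct_sum, ← Finset.add_sum_erase _ _ (Finset.mem_univ j), dotProduct_smul, hm1,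
    smul_eq_mul, mul_one] at h0
  have hrest : ∑ k ∈ Finset.univ.erase j, m ⬝ᵥ y k • toReal (A.col k) ≤ 0 := by
    refine Finset.sum_nonpos fun k hk => ?_
    have hkj := Finset.ne_of_mem_erase hk
    rw [dotProduct_smul, smul_eq_mul]
    refine mul_nonpos_of_nonneg_of_nonpos ?_ (hm0 k hkj)
    simp [y, hkj]
  have hyj : y j = x j := if_pos rfl
  linarith

end Chambers

/-! ### Minimal ray generators of a simplicial cone and of its dual -/

section Rays

variable {ι κ : Type*} [Fintype ι] {A : Matrix ι κ ℤ}

lemma ne_zero_of_gcd_eq_one {v : ι → ℤ} (h : Finset.univ.gcd v = 1) : v ≠ 0 := by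
  rintro rfl
  have : Finset.univ.gcd (0 : ι → ℤ) = 0 := Finset.gcd_eq_zero_iff.2 fun _ _ => rfl
  rw [this] at h
  exact zero_ne_one h

/-- A ray contains at most one primitive integer vector. -/
lemma eq_of_gcd_eq_one_of_smul_eq {v v' : ι → ℤ} (hv : Finset.univ.gcd v = 1)
    (hv' : Finset.univ.gcd v' = 1) {c : ℝ} (hc : 0 ≤ c) (h : toReal v = c • toReal v') :
    v = v' := by
  obtain ⟨i, hi⟩ := Function.ne_iff.1 (ne_zero_of_gcd_eq_one hv')
  have hcoord : ∀ j, (v j : ℝ) = c * v' j := fun j => congrFun h j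
  -- Proportional integer vectors with gcd one have coordinates of equal absolute value.
  have hcross : ∀ j, v' i * v j = v i * v' j := by
    intro j
    have : (v' i : ℝ) * v j = v i * v' j := by rw [hcoord i, hcoord j]; ring
    exact_mod_cast this
  have hg : normalize (v' i) = normalize (v i) := by
    have h1 := Finset.gcd_mul_left (s := Finset.univ) (f := v) (a := v' i)
    have h2 := Finset.gcd_mul_left (s := Finset.univ) (f := v') (a := v i)
    rw [hv, mul_one] at h1
    rw [hv', mul_one] at h2
    rw [← h1, ← h2]
    simp only [hcross]
  rw [← Int.abs_eq_normalize, ← Int.abs_eq_normalize] at hg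
  have hi' : (v' i : ℝ) ≠ 0 := by exact_mod_cast hi
  have hc1 : c = 1 := by
    have h3 : |(v' i : ℝ)| = |(v i : ℝ)| := by exact_mod_cast hg
    rw [hcoord i, abs_mul, abs_of_nonneg hc] at h3
    exact (mul_right_cancel₀ (abs_ne_zero.2 hi') (by rw [one_mul]; exact h3)).symm
  rw [hc1, one_smul] at h
  exact toReal_injective h

variable [Fintype κ] {s : Finset κ} {w : κ → ι → ℝ}

/-- A minimal ray generator of a simplicial cone lies on the ray of one of the columns. -/
lemma IsCoordSystem.exists_col_eq_smul (hw : IsCoordSystem A s w) {v : ι → ℤ}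
    (hv : IsMinimalRayGenerator v (posCone A (s : Set κ))) :
    ∃ k ∈ s, ∃ t : ℝ, 0 < t ∧ toReal (A.col k) = t • toReal v := by
  obtain ⟨hgcd, m, hm, hF⟩ := hv
  obtain ⟨hvσ, hmv⟩ := (hF (toReal v)).1 (mem_hull_singleton.2 ⟨1, zero_le_one, by simp⟩)
  have hv0 : toReal v ≠ 0 := fun h =>
    ne_zero_of_gcd_eq_one hgcd (toReal_injective (h.trans (by ext; simp [toReal])))
  have hcoord := hw.mem_posCone_iff.1 hvσ
  obtain ⟨k, hk, hkv⟩ : ∃ k ∈ s, w k ⬝ᵥ toReal v ≠ 0 := by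
    by_contra! hall
    apply hv0
    rw [← hw.sum_eq (toReal v)]
    exact Finset.sum_eq_zero fun k hk => by rw [hall k hk, zero_smul]
  rw [← hw.sum_eq (toReal v), dotProduct_sum, Finset.sum_eq_zero_iff_of_nonneg] at hmv
  swap
  · intro i hi
    rw [dotProduct_smul]
    exact mul_nonneg (hcoord i hi) (mem_dualCone.1 hm _ (col_mem_posCone hi))
  have hmk := hmv k hk
  rw [dotProduct_smul, smul_eq_mul] at hmk
  obtain ⟨t, ht, hkt⟩ := mem_hull_singleton.1
    ((hF _).2 ⟨col_mem_posCone hk, (mul_eq_zero.1 hmk).resolve_left hkv⟩)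
  refine ⟨k, hk, t, lt_of_le_of_ne ht ?_, hkt⟩
  rintro rfl
  have h1 := hw.self k hk
  rw [hkt, zero_smul, dotProduct_zero] at h1
  exact zero_ne_one h1

/-- A minimal ray generator of the dual of a simplicial cone lies on the ray of one of the
coordinate forms. -/
lemma IsCoordSystem.exists_dotProduct_eq_zero (hw : IsCoordSystem A s w) {m : ι → ℤ}
    (hm : IsMinimalRayGenerator m (dualCone (posCone A (s : Set κ)))) :
    ∃ k ∈ s, ∀ j ∈ s, j ≠ k → toReal m ⬝ᵥ toReal (A.col j) = 0 := by
  obtain ⟨hgcd, u, hu, hF⟩ := hm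
  obtain ⟨hmσ, hum⟩ := (hF (toReal m)).1 (mem_hull_singleton.2 ⟨1, zero_le_one, by simp⟩)
  have hm0 : toReal m ≠ 0 := fun h =>
    ne_zero_of_gcd_eq_one hgcd (toReal_injective (h.trans (by ext; simp [toReal])))
  have hexp : toReal m = ∑ k ∈ s, (toReal m ⬝ᵥ toReal (A.col k)) • w k := by
    refine dotProduct_eq _ _ fun z => ?_
    conv_lhs => rw [← hw.sum_eq z]
    rw [dotProduct_sum, sum_dotProduct]
    refine Finset.sum_congr rfl fun k _ => ?_
    rw [dotProduct_smul, smul_dotProduct, smul_eq_mul, smul_eq_mul, mul_comm]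
  obtain ⟨k, hk, hkm⟩ : ∃ k ∈ s, toReal m ⬝ᵥ toReal (A.col k) ≠ 0 := by
    by_contra! hall
    apply hm0
    rw [hexp]
    exact Finset.sum_eq_zero fun k hk => by rw [hall k hk, zero_smul]
  have hwd : ∀ i ∈ s, w i ∈ dualCone (posCone A (s : Set κ)) := fun i hi =>
    mem_dualCone.2 fun z hz => hw.mem_posCone_iff.1 hz i hi
  rw [hexp, dotProduct_sum, Finset.sum_eq_zero_iff_of_nonneg] at hum
  swap
  · intro i hi
    rw [dotProduct_smul]
    exact mul_nonneg (mem_dualCone.1 hmσ _ (col_mem_posCone hi))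
      (mem_dualCone.1 hu _ (hwd i hi))
  have huk := hum k hk
  rw [dotProduct_smul, smul_eq_mul] at huk
  obtain ⟨t, -, hkt⟩ := mem_hull_singleton.1
    ((hF _).2 ⟨hwd k hk, (mul_eq_zero.1 huk).resolve_left hkm⟩)
  refine ⟨k, hk, fun j hj hjk => ?_⟩
  have h0 := hw.ne k hk j hj hjk.symm
  rw [hkt, smul_dotProduct, smul_eq_mul] at h0
  refine (mul_eq_zero.1 h0).resolve_left ?_
  rintro rfl
  exact hw.coord_ne_zero hk (by rw [hkt, zero_smul])

/-- The dual ray matrix of a simplicial cone is, up to positive factors, the dual basis of the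
minimal ray generators. -/
lemma IsDualRayMatrix.dotProduct (hs : IsSimplicialIndex A s) {v : ι → ι → ℤ}
    (hv : IsRayOrdering v (posCone A (s : Set κ))) {M : Matrix ι ι ℤ}
    (hM : IsDualRayMatrix (posCone A (s : Set κ)) v M) :
    (∀ i k, i ≠ k → M i ⬝ᵥ v k = 0) ∧ ∀ i, 0 < M i ⬝ᵥ v i := by
  obtain ⟨w, hw⟩ := hs.exists_isCoordSystem
  have hmin : ∀ i, IsMinimalRayGenerator (v i) (posCone A (s : Set κ)) :=
    fun i => (hv.2 _).2 ⟨i, rfl⟩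
  choose φ hφ t ht hφt using fun i => hw.exists_col_eq_smul (hmin i)
  choose ψ hψ hψ0 using fun i => hw.exists_dotProduct_eq_zero (hM i).1
  have hφinj : Function.Injective φ := by
    intro i k hik
    refine hv.1 (eq_of_gcd_eq_one_of_smul_eq (hmin i).1 (hmin k).1 (c := (t i)⁻¹ * t k)
      (mul_nonneg (inv_nonneg.2 (ht i).le) (ht k).le) ?_)
    rw [mul_smul, ← hφt k, ← hik, hφt i, smul_smul, inv_mul_cancel₀ (ht i).ne', one_smul]
  have hψφ : ∀ i k, M i ⬝ᵥ v k ≠ 0 → φ k = ψ i := by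
    intro i k hne
    by_contra hne'
    apply hne
    have h0 := hψ0 i (φ k) (hφ k) hne'
    rw [hφt k, dotProduct_smul, smul_eq_mul, toReal_dotProduct] at h0
    exact_mod_cast (mul_eq_zero.1 h0).resolve_left (ht k).ne'
  refine ⟨fun i k hik => ?_, fun i => lt_of_le_of_ne ?_ (hM i).2.symm⟩
  · by_contra hne
    exact hik (hφinj ((hψφ i i (hM i).2).trans (hψφ i k hne).symm))
  · obtain ⟨-, m, -, hF⟩ := hmin i
    obtain ⟨-, m', -, hF'⟩ := (hM i).1
    have h1 := ((hF (toReal (v i))).1 (mem_hull_singleton.2 ⟨1, zero_le_one, by simp⟩)).1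
    have h2 := ((hF' (toReal (M i))).1 (mem_hull_singleton.2 ⟨1, zero_le_one, by simp⟩)).1
    have h3 := mem_dualCone.1 h2 _ h1
    rw [toReal_dotProduct] at h3
    exact_mod_cast h3

lemma eq_zero_of_dual_pairing {M v : ι → ι → ℝ} (h0 : ∀ i k, i ≠ k → M i ⬝ᵥ v k = 0)
    (h1 : ∀ i, M i ⬝ᵥ v i ≠ 0) {u : ι → ℝ} (hu : ∀ i, M i ⬝ᵥ u = 0) : u = 0 := by
  classical
  have hli : LinearIndependent ℝ M := by
    rw [Fintype.linearIndependent_iff]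
    intro c hc k
    have h2 : (∑ i, c i • M i) ⬝ᵥ v k = 0 := by rw [hc, zero_dotProduct]
    rw [sum_dotProduct, Finset.sum_eq_single k] at h2
    · rw [smul_dotProduct, smul_eq_mul] at h2
      exact (mul_eq_zero.1 h2).resolve_right (h1 k)
    · intro i _ hik
      rw [smul_dotProduct, h0 i k hik, smul_zero]
    · simp
  refine eq_zero_of_dotProduct_eq_zero (s := Set.range M)
    (hli.span_eq_top_of_card_eq_finrank' (by simp)) ?_
  rintro _ ⟨i, rfl⟩
  rw [dotProduct_comm]
  exact hu i

end Rays

/-! ### Semigroups of columns -/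

section Semigroups

variable {ι κ : Type*} [Fintype κ] {A : Matrix ι κ ℤ}

lemma mulVec_mem_semigroup {s : Set κ} {x : κ → ℕ} (hx : ∀ j, j ∉ s → x j = 0) :
    A *ᵥ (fun j => (x j : ℤ)) ∈ semigroup A s := by
  have : A *ᵥ (fun j => (x j : ℤ)) = ∑ j, x j • A.col j := by
    ext i
    simp [mulVec, dotProduct, Matrix.col, mul_comm]
  rw [this]
  refine AddSubmonoid.sum_mem _ fun j _ => ?_
  by_cases hj : j ∈ s
  · exact AddSubmonoid.nsmul_mem _ (AddSubmonoid.subset_closure (Set.mem_image_of_mem _ hj)) _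
  · rw [hx j hj, zero_smul]
    exact AddSubmonoid.zero_mem _

lemma exists_of_mem_semigroup {s : Set κ} {u : ι → ℤ} (hu : u ∈ semigroup A s) :
    ∃ x : κ → ℕ, (∀ j, j ∉ s → x j = 0) ∧ A *ᵥ (fun j => (x j : ℤ)) = u := by
  classical
  unfold semigroup at hu
  induction hu using AddSubmonoid.closure_induction with
  | mem u hu =>
    obtain ⟨j, hj, rfl⟩ := hu
    refine ⟨Pi.single j 1, fun k hk => ?_, ?_⟩
    · rw [Pi.single_apply, if_neg]
      rintro rfl
      exact hk hj
    · ext i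
      simp [mulVec, dotProduct, Pi.single_apply, Matrix.col]
  | zero => exact ⟨0, fun _ _ => rfl, by ext; simp [mulVec, dotProduct]⟩
  | add u v _ _ hu hv =>
    obtain ⟨x, hx, rfl⟩ := hu
    obtain ⟨y, hy, rfl⟩ := hv
    refine ⟨x + y, fun j hj => by simp [hx j hj, hy j hj], ?_⟩
    rw [← mulVec_add]
    congr 1

lemma mulVec_mem_lattice (x : κ → ℤ) : A *ᵥ x ∈ lattice A := by
  have : A *ᵥ x = ∑ j, x j • A.col j := by
    ext i
    simp [mulVec, dotProduct, Matrix.col, mul_comm]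
  rw [this]
  exact AddSubgroup.sum_mem _ fun j _ =>
    AddSubgroup.zsmul_mem _ (AddSubgroup.subset_closure (Set.mem_range_self j)) _

end Semigroups

/-! ### Projecting along the first columns -/

section Projection

variable {d n ℓ : ℕ}

lemma tailIdx_injective : Function.Injective (tailIdx ℓ : Fin (d - ℓ) → Fin d) := by
  intro i j h
  have := congrArg Fin.val h
  simp only [tailIdx] at this
  exact Fin.ext (by omega)

lemma exists_tailIdx_eq {j : Fin n} (hj : ℓ ≤ j) : ∃ k : Fin (n - ℓ), tailIdx ℓ k = j :=
  ⟨⟨j - ℓ, by omega⟩, Fin.ext (by simp [tailIdx]; omega)⟩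

lemma not_tailIdx_lt (k : Fin (n - ℓ)) : ¬ (tailIdx ℓ k : ℕ) < ℓ := by
  simp [tailIdx]

lemma sum_eq_head_add_tail {E : Type*} [AddCommMonoid E] (f : Fin n → E) :
    ∑ j, f j = ∑ j ∈ Finset.univ.filter (fun j : Fin n => (j : ℕ) < ℓ), f j +
      ∑ k : Fin (n - ℓ), f (tailIdx ℓ k) := by
  rw [← Finset.sum_filter_add_sum_filter_not Finset.univ (fun j : Fin n => (j : ℕ) < ℓ)]
  congr 1
  symm
  refine Finset.sum_bij (fun k _ => tailIdx ℓ k) (fun k _ => ?_)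
    (fun _ _ _ _ h => tailIdx_injective h) (fun j hj => ?_) (fun _ _ => rfl)
  · simpa using not_tailIdx_lt k
  · obtain ⟨k, hk⟩ := exists_tailIdx_eq (not_lt.1 (Finset.mem_filter.1 hj).2)
    exact ⟨k, Finset.mem_univ _, hk⟩

lemma exists_extend_by_zero {R : Type*} [Zero R] (y : Fin (n - ℓ) → R) :
    ∃ y' : Fin n → R, (∀ k, y' (tailIdx ℓ k) = y k) ∧ ∀ j : Fin n, (j : ℕ) < ℓ → y' j = 0 := by
  refine ⟨fun j => if hj : ℓ ≤ j then y ⟨j - ℓ, by omega⟩ else 0, fun k => ?_,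
    fun j hj => dif_neg (not_le.2 hj)⟩
  have hk : ℓ ≤ (tailIdx ℓ k : ℕ) := not_lt.1 (not_tailIdx_lt k)
  simp only [dif_pos hk]
  congr 1
  exact Fin.ext (by simp [tailIdx])

/-- The map `u ↦ ((M u)_{ℓ+1}, …, (M u)_d)` on real vectors. -/
noncomputable def tailProj (ℓ : ℕ) (M : Matrix (Fin d) (Fin d) ℤ) :
    (Fin d → ℝ) →ₗ[ℝ] (Fin (d - ℓ) → ℝ) :=
  LinearMap.funLeft ℝ ℝ (tailIdx ℓ) ∘ₗ (M.map (Int.cast : ℤ → ℝ)).mulVecLin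

lemma tailProj_apply (M : Matrix (Fin d) (Fin d) ℤ) (u : Fin d → ℝ) (i : Fin (d - ℓ)) :
    tailProj ℓ M u i = toReal (M (tailIdx ℓ i)) ⬝ᵥ u := rfl

lemma tailProj_toReal (M : Matrix (Fin d) (Fin d) ℤ) (b : Fin d → ℤ) :
    tailProj ℓ M (toReal b) = toReal (dropVec ℓ (M *ᵥ b)) := by
  ext i
  rw [tailProj_apply, toReal_dotProduct]
  rfl

lemma tailProj_col_tail (M : Matrix (Fin d) (Fin d) ℤ) (A : Matrix (Fin d) (Fin n) ℤ)
    (k : Fin (n - ℓ)) :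
    tailProj ℓ M (toReal (A.col (tailIdx ℓ k))) = toReal ((dropMat ℓ (M * A)).col k) := by
  rw [tailProj_toReal]
  rfl

/-- `M` is invertible over `ℝ`, and the first `ℓ` columns of `M * A` form a diagonal block with
positive entries on top of a zero block. -/
structure IsReducing (ℓ : ℕ) (A : Matrix (Fin d) (Fin n) ℤ) (M : Matrix (Fin d) (Fin d) ℤ) :
    Prop where
  le_rows : ℓ ≤ d
  le_cols : ℓ ≤ n
  eq_zero : ∀ (i : Fin d) (j : Fin n), (j : ℕ) < ℓ → (i : ℕ) ≠ j → M i ⬝ᵥ A.col j = 0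
  pos : ∀ (i : Fin d) (j : Fin n), (j : ℕ) < ℓ → (i : ℕ) = j → 0 < M i ⬝ᵥ A.col j
  ker : ∀ u : Fin d → ℝ, (∀ i, toReal (M i) ⬝ᵥ u = 0) → u = 0

namespace IsReducing

variable {A : Matrix (Fin d) (Fin n) ℤ} {M : Matrix (Fin d) (Fin d) ℤ}

lemma tailProj_surjective (h : IsReducing ℓ A M) : Function.Surjective (tailProj ℓ M) := by
  have hinj : Function.Injective (M.map (Int.cast : ℤ → ℝ)).mulVecLin := by
    rw [← LinearMap.ker_eq_bot, LinearMap.ker_eq_bot']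
    exact fun u hu => h.ker u fun i => congrFun hu i
  have h1 : Function.Surjective (M.map (Int.cast : ℤ → ℝ)).mulVecLin :=
    LinearMap.injective_iff_surjective.1 hinj
  exact (LinearMap.funLeft_surjective_of_injective ℝ ℝ _ tailIdx_injective).comp h1

lemma tailProj_sum (h : IsReducing ℓ A M) (x : Fin n → ℝ) :
    tailProj ℓ M (∑ j, x j • toReal (A.col j)) =
      ∑ k, x (tailIdx ℓ k) • toReal ((dropMat ℓ (M * A)).col k) := by
  rw [map_sum, sum_eq_head_add_tail (ℓ := ℓ), Finset.sum_eq_zero, zero_add]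
  · exact Finset.sum_congr rfl fun k _ => by rw [map_smul, tailProj_col_tail]
  · intro j hj
    have hj := (Finset.mem_filter.1 hj).2
    rw [map_smul]
    convert smul_zero (x j)
    ext i
    rw [tailProj_apply, toReal_dotProduct, h.eq_zero _ j hj]
    · simp
    · simp only [tailIdx]; omega

lemma dotProduct_sum_head (h : IsReducing ℓ A M) {z : Fin n → ℝ}
    (hz : ∀ k : Fin (n - ℓ), z (tailIdx ℓ k) = 0) {i : Fin d} {j : Fin n} (hij : (i : ℕ) = j) :
    toReal (M i) ⬝ᵥ ∑ j, z j • toReal (A.col j) = z j * ((M i ⬝ᵥ A.col j : ℤ) : ℝ) := by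
  rw [dotProduct_sum, Finset.sum_eq_single j, dotProduct_smul, toReal_dotProduct, smul_eq_mul]
  · intro k _ hkj
    rw [dotProduct_smul, toReal_dotProduct]
    by_cases hk : (k : ℕ) < ℓ
    · rw [h.eq_zero i k hk (fun hik => hkj (Fin.ext (hik.symm.trans hij)))]
      simp
    · obtain ⟨k, rfl⟩ := exists_tailIdx_eq (not_lt.1 hk)
      rw [hz, zero_smul]
  · simp

lemma eq_zero_of_sum_eq_zero (h : IsReducing ℓ A M) {z : Fin n → ℝ}
    (hz : ∀ k : Fin (n - ℓ), z (tailIdx ℓ k) = 0) (h0 : ∑ j, z j • toReal (A.col j) = 0) :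
    z = 0 := by
  ext j
  by_cases hj : (j : ℕ) < ℓ
  · have h1 := h.dotProduct_sum_head hz (i := ⟨j, hj.trans_le h.le_rows⟩) (j := j) rfl
    rw [h0, dotProduct_zero] at h1
    have h2 := h.pos ⟨j, hj.trans_le h.le_rows⟩ j hj rfl
    exact (mul_eq_zero.1 h1.symm).resolve_right (by exact_mod_cast h2.ne')
  · obtain ⟨k, rfl⟩ := exists_tailIdx_eq (not_lt.1 hj)
    exact hz k

/-- The kernel of the projection is spanned by the first `ℓ` columns. -/
lemma exists_of_tailProj_eq_zero (h : IsReducing ℓ A M) {u : Fin d → ℝ}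
    (hu : tailProj ℓ M u = 0) :
    ∃ z : Fin n → ℝ, (∀ k : Fin (n - ℓ), z (tailIdx ℓ k) = 0) ∧
      u = ∑ j, z j • toReal (A.col j) := by
  let z : Fin n → ℝ := fun j => if hj : (j : ℕ) < ℓ then
    (toReal (M ⟨j, hj.trans_le h.le_rows⟩) ⬝ᵥ u) /
      ((M ⟨j, hj.trans_le h.le_rows⟩ ⬝ᵥ A.col j : ℤ) : ℝ) else 0
  have hz : ∀ k : Fin (n - ℓ), z (tailIdx ℓ k) = 0 := fun k => dif_neg (not_tailIdx_lt k)
  refine ⟨z, hz, sub_eq_zero.1 (h.ker _ fun i => ?_)⟩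
  rw [dotProduct_sub, sub_eq_zero]
  by_cases hi : (i : ℕ) < ℓ
  · have hpos := h.pos i ⟨i, hi.trans_le h.le_cols⟩ hi rfl
    rw [h.dotProduct_sum_head hz (j := ⟨i, hi.trans_le h.le_cols⟩) rfl]
    have hzi : z ⟨i, hi.trans_le h.le_cols⟩ = (toReal (M i) ⬝ᵥ u) /
      ((M i ⬝ᵥ A.col ⟨i, hi.trans_le h.le_cols⟩ : ℤ) : ℝ) := dif_pos hi
    rw [hzi, div_mul_cancel₀ _ (by exact_mod_cast hpos.ne')]
  · obtain ⟨k, rfl⟩ := exists_tailIdx_eq (not_lt.1 hi)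
    have h1 := congrFun (h.tailProj_sum z) k
    simp only [hz, zero_smul, Finset.sum_const_zero] at h1
    rw [tailProj_apply] at h1
    rw [h1, ← tailProj_apply, hu]

/-- A nonnegative representation of the projection of a point of the chamber lifts to a
nonnegative representation of the point itself. -/
lemma exists_lift (h : IsReducing ℓ A M) {γ : PointedCone ℝ (Fin d → ℝ)} (hγ : IsChamber A γ)
    {s : Finset (Fin n)} (hs : IsSimplicialIndex A s) (hγs : γ ≤ posCone A (s : Set (Fin n)))
    (hext : ∀ j : Fin n, (j : ℕ) < ℓ → IsExternal A j ∧ toReal (A.col j) ∈ γ)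
    {u : Fin d → ℝ} (hu : u ∈ γ) {y : Fin (n - ℓ) → ℝ} (hy : ∀ k, 0 ≤ y k)
    (huy : tailProj ℓ M u = ∑ k, y k • toReal ((dropMat ℓ (M * A)).col k)) :
    ∃ x : Fin n → ℝ, (∀ j, 0 ≤ x j) ∧ (∀ k, x (tailIdx ℓ k) = y k) ∧
      u = ∑ j, x j • toReal (A.col j) := by
  obtain ⟨y', hy', -⟩ := exists_extend_by_zero y
  obtain ⟨z, hz, hzu⟩ := h.exists_of_tailProj_eq_zero
    (u := u - ∑ j, y' j • toReal (A.col j))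
    (by rw [map_sub, h.tailProj_sum, huy]; simp [hy'])
  have hux : u = ∑ j, (z j + y' j) • toReal (A.col j) := by
    simp only [add_smul, Finset.sum_add_distrib]
    rw [← hzu, sub_add_cancel]
  refine ⟨fun j => z j + y' j, hγ.coeff_nonneg hs hγs (fun j hj => ?_) (hux ▸ hu),
    fun k => by simp [hz, hy'], hux⟩
  obtain ⟨k, rfl⟩ := exists_tailIdx_eq (not_lt.1 fun hlt => hj (hext j hlt))
  simpa [hz, hy'] using hy k

end IsReducing

end Projection

/-! ### The reduced matrix -/

section Reduction

variable {d n ℓ : ℕ} {A : Matrix (Fin d) (Fin n) ℤ} {M : Matrix (Fin d) (Fin d) ℤ}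
  {γ : PointedCone ℝ (Fin d → ℝ)} {s : Finset (Fin n)}

namespace IsReducing

lemma isAdmissible (h : IsReducing ℓ A M) (hA : IsAdmissible A) (hγ : IsChamber A γ)
    (hs : IsSimplicialIndex A s) (hγs : γ ≤ posCone A (s : Set (Fin n)))
    (hext : ∀ j : Fin n, (j : ℕ) < ℓ → IsExternal A j ∧ toReal (A.col j) ∈ γ) :
    IsAdmissible (dropMat ℓ (M * A)) := by
  classical
  refine ⟨?_, fun y hy hy0 => ?_⟩
  · have hsurj : Function.Surjective
        ((dropMat ℓ (M * A)).map (Int.cast : ℤ → ℝ)).mulVecLin := by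
      intro y
      obtain ⟨u, rfl⟩ := h.tailProj_surjective y
      obtain ⟨w, hw⟩ := hs.exists_isCoordSystem
      refine ⟨fun k => if tailIdx ℓ k ∈ s then w (tailIdx ℓ k) ⬝ᵥ u else 0, ?_⟩
      rw [mulVecLin_apply, map_mulVec_eq_sum,
        ← h.tailProj_sum (fun j => if j ∈ s then w j ⬝ᵥ u else 0)]
      conv_rhs => rw [← hw.sum_eq u]
      simp [ite_smul]
    rw [Matrix.rank, LinearMap.range_eq_top.2 hsurj, finrank_top,
      Module.finrank_fintype_fun_eq_card]
  · rw [map_mulVec_eq_sum] at hy0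
    obtain ⟨x, hx, hxy, hx0⟩ := h.exists_lift hγ hs hγs hext (Submodule.zero_mem γ) hy
      (by rw [map_zero, hy0])
    have := hA.2 x hx (by rw [map_mulVec_eq_sum, ← hx0])
    ext k
    rw [← hxy, this]
    rfl

/-- Adjoining the first `ℓ` columns turns a basis of columns of the reduced matrix into a basis
of columns of the given matrix. -/
lemma isSimplicialIndex_lift (h : IsReducing ℓ A M) {t : Finset (Fin (n - ℓ))}
    (ht : IsSimplicialIndex (dropMat ℓ (M * A)) t) :
    IsSimplicialIndex A (Finset.univ.filter fun j => ∀ k, tailIdx ℓ k = j → k ∈ t) := by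
  classical
  obtain ⟨hc, hli⟩ := isSimplicialIndex_iff.1 ht
  refine isSimplicialIndex_iff.2 ⟨?_, ?_⟩
  · rw [Finset.card_filter, sum_eq_head_add_tail (ℓ := ℓ)]
    have h1 : ∑ j ∈ Finset.univ.filter (fun j : Fin n => (j : ℕ) < ℓ),
        (if ∀ k, tailIdx ℓ k = j → k ∈ t then 1 else 0) = ℓ := by
      rw [Finset.sum_congr rfl (g := fun _ => 1)]
      · rw [Finset.sum_const, smul_eq_mul, mul_one, Fin.card_filter_val_lt,
          min_eq_right h.le_cols]
      · intro j hj
        refine if_pos fun k hk => absurd (Finset.mem_filter.1 hj).2 ?_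
        rw [← hk]
        exact not_tailIdx_lt k
    have h2 : ∑ k : Fin (n - ℓ),
        (if ∀ k', tailIdx ℓ k' = (tailIdx ℓ k : Fin n) → k' ∈ t then 1 else 0) = t.card := by
      simp [tailIdx_injective.eq_iff]
    rw [h1, h2, hc, Fintype.card_fin, Fintype.card_fin]
    have := h.le_rows
    omega
  · rw [linearIndepOn_finset_iff]
    intro f hf
    have hf' : ∑ j, (if ∀ k, tailIdx ℓ k = j → k ∈ t then f j else 0) • toReal (A.col j) = 0 := by
      rw [← hf, Finset.sum_filter]
      exact Finset.sum_congr rfl fun j _ => by rw [ite_smul, zero_smul]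
    have hP := h.tailProj_sum (fun j => if ∀ k, tailIdx ℓ k = j → k ∈ t then f j else 0)
    rw [hf', map_zero] at hP
    simp only [tailIdx_injective.eq_iff, forall_eq, ite_smul, zero_smul, ← Finset.sum_filter,
      Finset.filter_mem_eq_inter, Finset.univ_inter] at hP
    have htail := linearIndepOn_finset_iff.1 hli _ hP.symm
    have h0 := h.eq_zero_of_sum_eq_zero (fun k => ?_) hf'
    · intro j hj
      have := congrFun h0 j
      beta_reduce at this
      rwa [if_pos (Finset.mem_filter.1 hj).2] at this
    · simp only [tailIdx_injective.eq_iff, forall_eq]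
      split_ifs with hk
      · exact htail k hk
      · rfl

/-- The projection of a chamber is contained in a chamber of the reduced matrix. -/
lemma exists_chamber (h : IsReducing ℓ A M) (hγ : IsChamber A γ)
    (hs : IsSimplicialIndex A s) (hγs : γ ≤ posCone A (s : Set (Fin n)))
    (hext : ∀ j : Fin n, (j : ℕ) < ℓ → IsExternal A j ∧ toReal (A.col j) ∈ γ) :
    ∃ γ' : PointedCone ℝ (Fin (d - ℓ) → ℝ), IsChamber (dropMat ℓ (M * A)) γ' ∧
      ∀ u ∈ γ, tailProj ℓ M u ∈ γ' := by
  classical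
  obtain ⟨b, hb, hγb⟩ := hγ.exists_eq_coneAt
  have hbγ : b ∈ γ := hγb ▸ mem_coneAt.2 fun _ _ h => h
  have hmem : ∀ u ∈ γ, tailProj ℓ M u ∈ coneAt (dropMat ℓ (M * A)) (tailProj ℓ M b) := by
    intro u hu
    refine mem_coneAt.2 fun t ht hbt => ?_
    obtain ⟨y, hy, hyt, hby⟩ := mem_posCone_iff.1 hbt
    obtain ⟨x, hx, hxy, hbx⟩ := h.exists_lift hγ hs hγs hext hbγ hy hby
    have hbs : b ∈ posCone A
        ((Finset.univ.filter fun j => ∀ k, tailIdx ℓ k = j → k ∈ t : Finset (Fin n)) :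
          Set (Fin n)) := by
      refine mem_posCone_iff.2 ⟨x, hx, fun j hj => ?_, hbx⟩
      simp only [Finset.coe_filter, Finset.mem_univ, true_and, Set.mem_ofPred_eq, not_forall] at hj
      obtain ⟨k, rfl, hk⟩ := hj
      rw [hxy, hyt k hk]
    rw [hγb] at hu
    obtain ⟨z, hz, hzt, rfl⟩ :=
      mem_posCone_iff.1 (mem_coneAt.1 hu _ (h.isSimplicialIndex_lift ht) hbs)
    rw [h.tailProj_sum]
    refine mem_posCone_iff.2 ⟨fun k => z (tailIdx ℓ k), fun k => hz _, fun k hk => hzt _ ?_, rfl⟩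
    simpa [tailIdx_injective.eq_iff] using hk
  refine ⟨_, ⟨⟨tailProj ℓ M b, ?_, 0, ?_, fun u => ?_⟩, ?_⟩, hmem⟩
  · obtain ⟨x, hx, -, rfl⟩ := mem_posCone_iff.1 hb
    rw [h.tailProj_sum]
    exact mem_posCone_iff.2 ⟨_, fun k => hx _, fun k hk => absurd (Set.mem_univ k) hk, rfl⟩
  · exact Submodule.zero_mem _
  · rw [zero_dotProduct]
    exact (and_iff_left rfl).symm
  · have htop : Submodule.span ℝ
        (coneAt (dropMat ℓ (M * A)) (tailProj ℓ M b) : Set (Fin (d - ℓ) → ℝ)) = ⊤ := by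
      rw [eq_top_iff, ← LinearMap.range_eq_top.2 h.tailProj_surjective, LinearMap.range_eq_map,
        ← hγ.span_eq_top, Submodule.map_span]
      refine Submodule.span_mono ?_
      rintro _ ⟨u, hu, rfl⟩
      exact hmem u hu
    rw [coneDim, htop, finrank_top, Module.finrank_fintype_fun_eq_card]

/-- Saturation makes the lifted coefficients integral. -/
lemma exists_nat_lift (h : IsReducing ℓ A M) (hγ : IsChamber A γ)
    (hs : IsSimplicialIndex A s) (hγs : γ ≤ posCone A (s : Set (Fin n)))
    (hext : ∀ j : Fin n, (j : ℕ) < ℓ → IsExternal A j ∧ toReal (A.col j) ∈ γ)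
    (hsat : IsSaturated (semigroup A {j | (j : ℕ) < ℓ}) (lattice A))
    {b : Fin d → ℤ} (hbγ : toReal b ∈ γ) (hb : b ∈ lattice A) {y : Fin (n - ℓ) → ℕ}
    (hy : dropMat ℓ (M * A) *ᵥ (fun k => (y k : ℤ)) = dropVec ℓ (M *ᵥ b)) :
    ∃ x : Fin n → ℕ, (∀ k, x (tailIdx ℓ k) = y k) ∧ A *ᵥ (fun j => (x j : ℤ)) = b := by
  classical
  obtain ⟨x, hx, hxy, hbx⟩ := h.exists_lift hγ hs hγs hext hbγ (y := fun k => (y k : ℝ))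
    (fun k => Nat.cast_nonneg _)
    (by rw [tailProj_toReal, ← hy, toReal_mulVec]; simp)
  obtain ⟨y', hy', hy'0⟩ := exists_extend_by_zero y
  obtain ⟨u, hu⟩ : ∃ u, u = b - A *ᵥ (fun j => (y' j : ℤ)) := ⟨_, rfl⟩
  let z : Fin n → ℝ := fun j => x j - y' j
  have hzt : ∀ k : Fin (n - ℓ), z (tailIdx ℓ k) = 0 := fun k => by simp [z, hxy, hy']
  have huz : toReal u = ∑ j, z j • toReal (A.col j) := by
    rw [hu, toReal_sub, hbx, toReal_mulVec, ← Finset.sum_sub_distrib]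
    exact Finset.sum_congr rfl fun j _ => by simp [z, sub_smul]
  -- The coefficients `z j` are nonnegative rational numbers.
  have hrat : ∀ j, ∃ N a : ℕ, 0 < N ∧ (N : ℝ) * z j = a ∧ (¬ (j : ℕ) < ℓ → a = 0) := by
    intro j
    by_cases hj : (j : ℕ) < ℓ
    · have hpos := h.pos ⟨j, hj.trans_le h.le_rows⟩ j hj rfl
      have hdot := h.dotProduct_sum_head hzt (i := ⟨j, hj.trans_le h.le_rows⟩) (j := j) rfl
      rw [← huz, toReal_dotProduct] at hdot
      have hzj : 0 ≤ z j := by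
        simpa [z, hy'0 j hj] using hx j
      have hnum : 0 ≤ M ⟨j, hj.trans_le h.le_rows⟩ ⬝ᵥ u := by
        have : (0 : ℝ) ≤ ((M ⟨j, hj.trans_le h.le_rows⟩ ⬝ᵥ u : ℤ) : ℝ) := by
          rw [hdot]
          exact mul_nonneg hzj (by exact_mod_cast hpos.le)
        exact_mod_cast this
      obtain ⟨N, hN⟩ := Int.eq_ofNat_of_zero_le hpos.le
      obtain ⟨a, ha⟩ := Int.eq_ofNat_of_zero_le hnum
      rw [hN, ha] at hdot
      refine ⟨N, a, by omega, ?_, fun h' => absurd hj h'⟩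
      rw [mul_comm]
      exact_mod_cast hdot.symm
    · obtain ⟨k, rfl⟩ := exists_tailIdx_eq (not_lt.1 hj)
      exact ⟨1, 0, one_pos, by rw [hzt]; simp, fun _ => rfl⟩
  choose N a hN hNa ha0 using hrat
  have hKu : (∏ j, N j) • u =
      A *ᵥ (fun j => (((∏ i ∈ Finset.univ.erase j, N i) * a j : ℕ) : ℤ)) := by
    apply toReal_injective
    have hl : toReal ((∏ j, N j) • u) = ((∏ j, N j : ℕ) : ℝ) • toReal u := by
      ext i
      simp [toReal]
    rw [hl, toReal_mulVec, huz, Finset.smul_sum]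
    refine Finset.sum_congr rfl fun j _ => ?_
    rw [smul_smul, ← Finset.mul_prod_erase _ _ (Finset.mem_univ j)]
    congr 1
    push_cast
    rw [← hNa j]
    ring
  obtain ⟨c, hc, hcu⟩ := exists_of_mem_semigroup (hsat (∏ j, N j)
    (Finset.prod_pos fun j _ => hN j) u
    (hu ▸ AddSubgroup.sub_mem _ hb (mulVec_mem_lattice _))
    (by
      rw [hKu]
      refine mulVec_mem_semigroup fun j hj => ?_
      rw [ha0 j hj, mul_zero]))
  refine ⟨fun j => c j + y' j, fun k => ?_, ?_⟩
  · simp only [hc _ (not_tailIdx_lt k), hy', zero_add]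
  · have : (fun j => ((c j + y' j : ℕ) : ℤ)) = (fun j => (c j : ℤ)) + fun j => (y' j : ℤ) := by
      ext j
      simp
    rw [this, mulVec_add, hcu, hu, sub_add_cancel]

lemma partitionFun_eq (h : IsReducing ℓ A M) (hγ : IsChamber A γ)
    (hs : IsSimplicialIndex A s) (hγs : γ ≤ posCone A (s : Set (Fin n)))
    (hext : ∀ j : Fin n, (j : ℕ) < ℓ → IsExternal A j ∧ toReal (A.col j) ∈ γ)
    (hsat : IsSaturated (semigroup A {j | (j : ℕ) < ℓ}) (lattice A))
    {b : Fin d → ℤ} (hbγ : toReal b ∈ γ) (hb : b ∈ semigroup A Set.univ) :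
    partitionFun A b = partitionFun (dropMat ℓ (M * A)) (dropVec ℓ (M *ᵥ b)) := by
  refine Set.ncard_congr (fun x _ k => x (tailIdx ℓ k)) (fun x hx => ?_) (fun x x' hx hx' hxx => ?_)
    (fun y hy => ?_)
  · have hx : A *ᵥ (fun j => (x j : ℤ)) = b := hx
    apply toReal_injective
    rw [← tailProj_toReal, ← hx, toReal_mulVec, toReal_mulVec, h.tailProj_sum]
  · have hx : A *ᵥ (fun j => (x j : ℤ)) = b := hx
    have hx' : A *ᵥ (fun j => (x' j : ℤ)) = b := hx'
    have h0 := h.eq_zero_of_sum_eq_zero (z := fun j => (x j : ℝ) - x' j)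
      (fun k => sub_eq_zero.2 (by exact_mod_cast congrFun hxx k)) (by
        have := congrArg toReal (hx.trans hx'.symm)
        rw [toReal_mulVec, toReal_mulVec] at this
        simp only [sub_smul, Finset.sum_sub_distrib]
        exact sub_eq_zero.2 (by exact_mod_cast this))
    ext j
    exact_mod_cast sub_eq_zero.1 (congrFun h0 j)
  · obtain ⟨x, -, hx⟩ := exists_of_mem_semigroup hb
    obtain ⟨x, hxy, hxb⟩ := h.exists_nat_lift hγ hs hγs hext hsat hbγ
      (hx ▸ mulVec_mem_lattice _) hy
    exact ⟨x, hxb, funext hxy⟩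

end IsReducing

/-- The dual ray matrix of a simplicial cone containing the chamber is reducing. -/
lemma isReducing_of_isDualRayMatrix (hℓn : ℓ ≤ n) (hs : IsSimplicialIndex A s)
    (hγs : γ ≤ posCone A (s : Set (Fin n)))
    (hext : ∀ j : Fin n, (j : ℕ) < ℓ → IsExternal A j ∧ toReal (A.col j) ∈ γ)
    {v : Fin d → Fin d → ℤ} (hv : IsRayOrdering v (posCone A (s : Set (Fin n))))
    (hvA : ∀ (i : Fin d) (j : Fin n), (i : ℕ) = (j : ℕ) → (j : ℕ) < ℓ →
      ∃ c : ℝ, 0 < c ∧ toReal (A.col j) = c • toReal (v i))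
    (hM : IsDualRayMatrix (posCone A (s : Set (Fin n))) v M) : IsReducing ℓ A M := by
  classical
  obtain ⟨h0, h1⟩ := hM.dotProduct hs hv
  have hℓd : ℓ ≤ d := by
    have hsub : (Finset.univ.filter fun j : Fin n => (j : ℕ) < ℓ) ⊆ s := by
      intro j hj
      have hj := hext j (Finset.mem_filter.1 hj).2
      exact_mod_cast hj.1.mem_of_mem_posCone (hγs hj.2)
    have := Finset.card_le_card hsub
    rwa [Fin.card_filter_val_lt, min_eq_right hℓn, hs.1, Fintype.card_fin] at this
  have hdot : ∀ (i : Fin d) (j : Fin n) (hj : (j : ℕ) < ℓ), ∃ c : ℝ, 0 < c ∧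
      ((M i ⬝ᵥ A.col j : ℤ) : ℝ) = c * ((M i ⬝ᵥ v ⟨j, hj.trans_le hℓd⟩ : ℤ) : ℝ) := by
    intro i j hj
    obtain ⟨c, hc, hcj⟩ := hvA ⟨j, hj.trans_le hℓd⟩ j rfl hj
    refine ⟨c, hc, ?_⟩
    rw [← toReal_dotProduct, hcj, dotProduct_smul, toReal_dotProduct, smul_eq_mul]
  refine ⟨hℓd, hℓn, fun i j hj hij => ?_, fun i j hj hij => ?_, fun u hu => ?_⟩
  · obtain ⟨c, -, hcj⟩ := hdot i j hj
    rw [h0 i _ (fun h => hij (congrArg Fin.val h)), Int.cast_zero, mul_zero] at hcj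
    exact_mod_cast hcj
  · obtain ⟨c, hc, hcj⟩ := hdot i j hj
    have hi : (⟨j, hj.trans_le hℓd⟩ : Fin d) = i := Fin.ext hij.symm
    rw [hi] at hcj
    have : (0 : ℝ) < ((M i ⬝ᵥ A.col j : ℤ) : ℝ) :=
      hcj ▸ mul_pos hc (by exact_mod_cast h1 i)
    exact_mod_cast this
  · refine eq_zero_of_dual_pairing (M := fun i => toReal (M i)) (v := fun i => toReal (v i))
      (fun i k hik => ?_) (fun i => ?_) hu
    · rw [toReal_dotProduct, h0 i k hik, Int.cast_zero]
    · rw [toReal_dotProduct]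
      exact_mod_cast (h1 i).ne'

end Reduction

end VPF

theorem theorem4p1 (d n ℓ : ℕ) (hℓn : ℓ ≤ n)
    (A : Matrix (Fin d) (Fin n) ℤ) (hA : VPF.IsAdmissible A)
    (γ : PointedCone ℝ (Fin d → ℝ)) (hγ : VPF.IsChamber A γ)
    -- the external columns of `A` in `γ` are exactly the first `ℓ` columns
    (hext : ∀ j : Fin n,
      (VPF.IsExternal A j ∧ VPF.toReal (A.col j) ∈ γ) ↔ (j : ℕ) < ℓ)
    (hsat : VPF.IsSaturated (VPF.semigroup A {j | (j : ℕ) < ℓ}) (VPF.lattice A))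
    -- `σ = posCone A s` is a simplicial cone of `A` that contains `γ`
    (s : Finset (Fin n)) (hs : VPF.IsSimplicialIndex A s)
    (hγs : γ ≤ VPF.posCone A (s : Set (Fin n)))
    -- the minimal ray generators of `σ`, the first `ℓ` of them in the order of the first columns
    (v : Fin d → Fin d → ℤ) (hv : VPF.IsRayOrdering v (VPF.posCone A (s : Set (Fin n))))
    (hvA : ∀ (i : Fin d) (j : Fin n), (i : ℕ) = (j : ℕ) → (j : ℕ) < ℓ →
      ∃ c : ℝ, 0 < c ∧ VPF.toReal (A.col j) = c • VPF.toReal (v i))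
    (M : Matrix (Fin d) (Fin d) ℤ)
    (hM : VPF.IsDualRayMatrix (VPF.posCone A (s : Set (Fin n))) v M) :
    ℓ ≤ d ∧
    VPF.IsAdmissible (VPF.dropMat ℓ (M * A)) ∧
    ∃ γ' : PointedCone ℝ (Fin (d - ℓ) → ℝ),
      VPF.IsChamber (VPF.dropMat ℓ (M * A)) γ' ∧
      (∀ b : Fin d → ℤ, VPF.toReal b ∈ γ → b ∈ VPF.semigroup A Set.univ →
        VPF.toReal (VPF.dropVec ℓ (M *ᵥ b)) ∈ γ' ∧
        VPF.partitionFun A b =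
          VPF.partitionFun (VPF.dropMat ℓ (M * A)) (VPF.dropVec ℓ (M *ᵥ b))) ∧
      ∀ (q : (Fin d → ℤ) → ℚ) (q' : (Fin (d - ℓ) → ℤ) → ℚ),
        VPF.IsChamberQuasiPolynomial A γ q →
        VPF.IsChamberQuasiPolynomial (VPF.dropMat ℓ (M * A)) γ' q' →
        ∀ b : Fin d → ℤ, VPF.toReal b ∈ γ → b ∈ VPF.semigroup A Set.univ →
          q b = q' (VPF.dropVec ℓ (M *ᵥ b)) := by
  have hext' := fun j hj => (hext j).2 hj
  have h := VPF.isReducing_of_isDualRayMatrix hℓn hs hγs hext' hv hvA hM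
  obtain ⟨γ', hγ', hmem⟩ := h.exists_chamber hγ hs hγs hext'
  have hmem' : ∀ b : Fin d → ℤ, VPF.toReal b ∈ γ →
      VPF.toReal (VPF.dropVec ℓ (M *ᵥ b)) ∈ γ' := fun b hb =>
    VPF.tailProj_toReal (ℓ := ℓ) M b ▸ hmem _ hb
  refine ⟨h.le_rows, h.isAdmissible hA hγ hs hγs hext', γ', hγ', fun b hbγ hb =>
    ⟨hmem' b hbγ, h.partitionFun_eq hγ hs hγs hext' hsat hbγ hb⟩,
    fun q q' hq hq' b hbγ hb => ?_⟩
  rw [hq.2 b hbγ, hq'.2 _ (hmem' b hbγ), h.partitionFun_eq hγ hs hγs hext' hsat hbγ hb]
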